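/- Let $r\ge 1$ and let $a(1),\dots,a(r)$ be integers with $\sum_{i=1}^{k-1}a(i)<a(k)$ for all $1\le k\le r$ (so they are positive and the $2^r-1$ sums of distinct elements of $\{a(1),\dots,a(r)\}$ with at least one summand are pairwise distinct). Let $A'=\{\alpha(1)<\dots<\alpha(2^r-1)\}$ be the set of these sums, and for $\alpha\in A'$ let $w(\alpha)$ be the number of summands in the sum defining $\alpha$. Let $N$ be an integer with $N\ge \alpha(2^r-1)=a(1)+\cdots+a(r)$, and put $a(r+1)=N+a(1)$. Write $(b;Q)_\infty=\prod_{n\ge 0}(1-bQ^n)$ and $${m \brack k}_Q=\frac{(1-Q^m)(1-Q^{m-1})\cdots(1-Q^{m-k+1})}{(1-Q)(1-Q^2)\cdots(1-Q^k)}\ \text{ if } 0\le k\le m,\qquad {m \brack k}_Q=0\ \text{ otherwise.}$$ Let $d,q\in\mathbb{C}$ with $|d|<1$, $|q|<1$, and let $f$ be a complex function, continuous at $0$ with $f(0)=1$, that satisfies for all complex $x$ with $|x|\le 1$ the $q$-difference equation $(\mathrm{eq}_{N,r})$ $$\prod_{j=1}^{r}\left(1-dxq^{a(j)}\right)f(x)=f\left(xq^N\right)+\sum_{j=1}^{r}\left(\sum_{m=0}^{r-j}d^m\sum_{\substack{\alpha\in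 A',\ \alpha<a(r+1)\\ w(\alpha)=j+m}}xq^{\alpha}\left((-x)^{m-1}{j+m-1\brack m-1}_{q^N}+(-x)^m{j+m\brack m}_{q^N}\right)\right)\prod_{h=1}^{j-1}\left(1-xq^{hN}\right)f\left(xq^{jN}\right),$$ where the term with $(-x)^{m-1}$ is $0$ for $m=0$. Then $$f(1)=\prod_{k=1}^r\frac{(-q^{a(k)};q^N)_\infty}{(dq^{a(k)};q^N)_\infty}.$$ -/

import Mathlib

/-- The `q`-binomial coefficient with top `m` and bottom `r` in base `Q`; it is zero unless
`0 ≤ r ≤ m`. -/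
noncomputable def qBinom (Q : ℂ) (m r : ℤ) : ℂ :=
  if 0 ≤ r ∧ r ≤ m then
    (∏ i ∈ Finset.range r.toNat, (1 - Q ^ (m.toNat - i))) /
      ∏ i ∈ Finset.range r.toNat, (1 - Q ^ (i + 1))
  else 0

/-- The infinite `q`-Pochhammer symbol `(b; Q)_∞ = ∏_{n ≥ 0} (1 - b Q ^ n)`. -/
noncomputable def qPochInf (b Q : ℂ) : ℂ := ∏' n : ℕ, (1 - b * Q ^ n)

/-- The product defining `(b; Q)_∞` converges whenever `|Q| < 1`. -/
theorem multipliable_qPochInf (b Q : ℂ) (hQ : ‖Q‖ < 1) :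
    Multipliable fun n : ℕ => 1 - b * Q ^ n := by
  have h : Summable fun n : ℕ => ‖-(b * Q ^ n)‖ := by
    simp only [norm_neg, norm_mul, norm_pow]
    exact (summable_geometric_of_lt_one (norm_nonneg _) hQ).mul_left _
  simpa [sub_eq_add_neg] using multipliable_one_add_of_summable h

/-- The set `A'` of all sums of distinct elements of `{a 1, ..., a r}` with at least one
summand. -/
def sumSet (a : ℕ → ℕ) (r : ℕ) : Finset ℕ :=
  ((Finset.Icc 1 r).powerset.erase ∅).image fun T => ∑ i ∈ T, a i

/-- `w α`, the number of terms in the sum of distinct elements of `{a 1, ..., a r}` defining `α`.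
When `a k` exceeds `a 1 + ... + a (k - 1)` for all `k`, distinct index sets have distinct sums, so
the set below has exactly one element for every `α` in `sumSet a r`. -/
noncomputable def weight (a : ℕ → ℕ) (r α : ℕ) : ℕ :=
  sInf {n | ∃ T ⊆ Finset.Icc 1 r, ∑ i ∈ T, a i = α ∧ T.card = n}

/-- The `q`-difference equation `(eq_{N,r})` for the function `f` at the point `x`; the bound
`α < a (r + 1)` of the inner sum is written with the convention `a (r + 1) = N + a 1`. -/
def QDiffEq (a : ℕ → ℕ) (r N : ℕ) (d q : ℂ) (f : ℂ → ℂ) (x : ℂ) : Prop :=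
  (∏ j ∈ Finset.Icc 1 r, (1 - d * x * q ^ a j)) * f x =
    f (x * q ^ N) +
      ∑ j ∈ Finset.Icc 1 r,
        (∑ m ∈ Finset.range (r - j + 1),
          d ^ m * ∑ α ∈ (sumSet a r).filter (fun α => α < N + a 1 ∧ weight a r α = j + m),
            x * q ^ α *
              ((-x) ^ ((m : ℤ) - 1) * qBinom (q ^ N) ((j : ℤ) + m - 1) ((m : ℤ) - 1) +
                (-x) ^ m * qBinom (q ^ N) ((j : ℤ) + m) m)) *
        (∏ h ∈ Finset.Icc 1 (j - 1), (1 - x * q ^ (h * N))) * f (x * q ^ (j * N))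

/-!
Write `Q = q ^ N` and `y i = q ^ a i`. Distinct index sets have distinct sums, and all sums are at
most `N < a (r + 1)`, so the inner sums of the equation are the elementary symmetric functions
`e k` of the `y i`, and nothing else about the `a i` matters. Put `F = f / (x; Q)_∞`. With the
dilation `η F (x) = F (x Q)` and `U = η - d x`, the `q`-binomial theorem
`U ^ k = ∑ [k, m] (-d x) ^ m η ^ (k - m)` turns the equation into
`(1 - η) F = x W(U) F`, where `W = E + d (E - 1) / X` and `E = ∏ (1 + y i X)`
(`DiscSummable.seriesSum_shiftOp_pow`, `functional_eq_of_binomial_sum`).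

In this form a power series solution is built one `y` at a time, starting from `1 / (x; Q)_∞` for
the empty set. Multiply the coefficient of `x ^ n` by `(1 + y) ⋯ (1 + y Q ^ (n - 1))` and the
resulting series by `1 / (d y x; Q)_∞`. This operation commutes with `U` (`insertOp_commute`), hence
with `W(U)`, and takes a solution for `E` to one for `(1 + y X) E` (`SeriesEq.insert`). On the limit
of the coefficients it acts as multiplication by `(-y; Q)_∞ / (d y; Q)_∞`
(`tendsto_coeff_insertOp`).

A solution of the equation that is continuous at `0` is determined in the unit disc by its value at
`0`, since the equation controls its value at `x` by those at `x Q ^ j`, `j ≥ 1`, up to a factor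
`1 + O(|x|)` (`eq_zero_of_dominated`). So `f = (x; Q)_∞ F` there. The equation at `1` shows that
`f (1)` is the limit of `f (t)` as `t` increases to `1`, and by Abel's theorem this limit is
`(Q; Q)_∞` times the limit of the coefficients of `F`.
-/

/-! ### Operators on power series -/

/-- The power series `∑ (z X) ^ n / ((1 - Q) ⋯ (1 - Q ^ n))`, Euler's expansion of
`1 / (z X; Q)_∞`. -/
noncomputable def eulerSeries (Q z : ℂ) : PowerSeries ℂ :=
  PowerSeries.mk fun n => z ^ n / ∏ i ∈ Finset.range n, (1 - Q ^ (i + 1))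

/-- The operator `U = η - d X` on power series, where `η` is the dilation `F(X) ↦ F(Q X)` and `X`
stands for multiplication by the variable. -/
noncomputable def shiftOp (Q d : ℂ) : Module.End ℂ (PowerSeries ℂ) where
  toFun F := PowerSeries.rescale Q F - d • (PowerSeries.X * F)
  map_add' F G := by
    rw [map_add, mul_add, smul_add]; abel
  map_smul' c F := by
    rw [mul_smul_comm]
    ext n
    simp only [map_sub, PowerSeries.coeff_rescale, PowerSeries.coeff_smul, smul_eq_mul,
      RingHom.id_apply]
    ring

/-- The diagonal operator multiplying the coefficient of `X ^ n` by
`(1 + y) (1 + y Q) ⋯ (1 + y Q ^ (n - 1))`. -/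
noncomputable def diagOp (Q y : ℂ) : Module.End ℂ (PowerSeries ℂ) where
  toFun F := PowerSeries.mk fun n =>
    (∏ k ∈ Finset.range n, (1 + y * Q ^ k)) * PowerSeries.coeff n F
  map_add' F G := by ext n; simp [mul_add]
  map_smul' c F := by ext n; simp; ring

/-- The operator `G ↦ (diagOp G) / (d y X; Q)_∞`, which inserts the parameter `y` into a solution
of the `q`-difference equation. -/
noncomputable def insertOp (Q d y : ℂ) : Module.End ℂ (PowerSeries ℂ) :=
  LinearMap.mulLeft ℂ (eulerSeries Q (d * y)) * diagOp Q y

theorem one_sub_pow_ne_zero {Q : ℂ} (hQ : ‖Q‖ < 1) (n : ℕ) : 1 - Q ^ (n + 1) ≠ 0 := by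
  intro h
  have h1 : ‖Q ^ (n + 1)‖ = 1 := by rw [← sub_eq_zero.mp h]; simp
  rw [norm_pow] at h1
  exact (pow_lt_one₀ (norm_nonneg _) hQ n.succ_ne_zero).ne h1

theorem prod_one_sub_pow_ne_zero {Q : ℂ} (hQ : ‖Q‖ < 1) (n : ℕ) :
    ∏ i ∈ Finset.range n, (1 - Q ^ (i + 1)) ≠ 0 :=
  Finset.prod_ne_zero_iff.mpr fun i _ => one_sub_pow_ne_zero hQ i

theorem coeff_zero_eulerSeries (Q z : ℂ) : PowerSeries.coeff 0 (eulerSeries Q z) = 1 := by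
  simp [eulerSeries]

theorem coeff_eulerSeries (Q z : ℂ) (n : ℕ) : PowerSeries.coeff n (eulerSeries Q z) =
    PowerSeries.coeff n (eulerSeries Q 1) * z ^ n := by
  simp [eulerSeries]; ring

theorem rescale_eulerSeries {Q : ℂ} (hQ : ‖Q‖ < 1) (z : ℂ) :
    PowerSeries.rescale Q (eulerSeries Q z) =
      (1 - PowerSeries.C z * PowerSeries.X) * eulerSeries Q z := by
  ext n
  rw [sub_mul, one_mul, mul_assoc, map_sub, PowerSeries.coeff_C_mul, PowerSeries.coeff_rescale]
  cases n with
  | zero => simp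
  | succ n =>
    rw [PowerSeries.coeff_succ_X_mul]
    simp only [eulerSeries, PowerSeries.coeff_mk, Finset.prod_range_succ]
    have h1 := one_sub_pow_ne_zero hQ n
    have h2 := prod_one_sub_pow_ne_zero hQ n
    field_simp
    ring

theorem shiftOp_apply (Q d : ℂ) (F : PowerSeries ℂ) : shiftOp Q d F =
    PowerSeries.rescale Q F - PowerSeries.C d * (PowerSeries.X * F) := by
  rw [← PowerSeries.smul_eq_C_mul]; rfl

theorem insertOp_apply (Q d y : ℂ) (F : PowerSeries ℂ) :
    insertOp Q d y F = eulerSeries Q (d * y) * diagOp Q y F := rfl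

theorem coeff_diagOp (Q y : ℂ) (F : PowerSeries ℂ) (n : ℕ) : PowerSeries.coeff n (diagOp Q y F) =
    (∏ k ∈ Finset.range n, (1 + y * Q ^ k)) * PowerSeries.coeff n F := by
  simp [diagOp]

theorem diagOp_rescale (Q y : ℂ) (F : PowerSeries ℂ) :
    diagOp Q y (PowerSeries.rescale Q F) = PowerSeries.rescale Q (diagOp Q y F) := by
  ext n
  simp only [coeff_diagOp, PowerSeries.coeff_rescale]
  ring

theorem diagOp_X_mul (Q y : ℂ) (F : PowerSeries ℂ) :
    diagOp Q y (PowerSeries.X * F) = PowerSeries.X *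
      (diagOp Q y F + PowerSeries.C y * PowerSeries.rescale Q (diagOp Q y F)) := by
  ext n
  cases n with
  | zero => simp [coeff_diagOp]
  | succ n =>
    simp only [coeff_diagOp, PowerSeries.coeff_succ_X_mul, map_add, PowerSeries.coeff_C_mul,
      PowerSeries.coeff_rescale, Finset.prod_range_succ]
    ring

theorem diagOp_C_mul (Q y c : ℂ) (F : PowerSeries ℂ) :
    diagOp Q y (PowerSeries.C c * F) = PowerSeries.C c * diagOp Q y F := by
  rw [← PowerSeries.smul_eq_C_mul, map_smul, PowerSeries.smul_eq_C_mul]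

/-- Conjugating `U` by `1 / (d y X; Q)_∞` turns it into `η - d X (1 + y η)`, and conjugating that
by the diagonal operator turns it back into `U`. -/
theorem insertOp_commute {Q : ℂ} (hQ : ‖Q‖ < 1) (d y : ℂ) :
    Commute (insertOp Q d y) (shiftOp Q d) := by
  refine LinearMap.ext fun F => ?_
  simp only [Module.End.mul_apply, insertOp_apply, shiftOp_apply, map_sub, map_mul,
    diagOp_C_mul, diagOp_X_mul, diagOp_rescale, rescale_eulerSeries hQ]
  ring

theorem Commute.aeval_right {A : Type*} [Ring A] [Algebra ℂ A] {a b : A} (h : Commute a b)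
    (p : Polynomial ℂ) : Commute a (Polynomial.aeval b p) := by
  induction p using Polynomial.induction_on' with
  | add p q hp hq => rw [map_add]; exact hp.add_right hq
  | monomial n c =>
    rw [Polynomial.aeval_monomial]
    exact (Algebra.commute_algebraMap_right c a).mul_right (h.pow_right n)

/-- The `q`-difference equation `(1 - η) F = X W(U) F` for power series. -/
def SeriesEq (Q d : ℂ) (W : Polynomial ℂ) (F : PowerSeries ℂ) : Prop :=
  F - PowerSeries.rescale Q F = PowerSeries.X * Polynomial.aeval (shiftOp Q d) W F

theorem seriesEq_one {Q : ℂ} (hQ : ‖Q‖ < 1) (d : ℂ) : SeriesEq Q d 1 (eulerSeries Q 1) := by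
  rw [SeriesEq, rescale_eulerSeries hQ]
  simp
  ring

/-- The inductive step of the construction: a solution for `W` yields one for
`(1 + y X) W + d y`. -/
theorem SeriesEq.insert {Q d : ℂ} (hQ : ‖Q‖ < 1) (y : ℂ) {W : Polynomial ℂ}
    {G : PowerSeries ℂ} (h : SeriesEq Q d W G) :
    SeriesEq Q d ((1 + Polynomial.C y * Polynomial.X) * W + Polynomial.C (d * y))
      (insertOp Q d y G) := by
  have hc : Polynomial.aeval (shiftOp Q d) W (insertOp Q d y G) =
      insertOp Q d y (Polynomial.aeval (shiftOp Q d) W G) :=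
    (LinearMap.congr_fun ((insertOp_commute hQ d y).aeval_right W).eq G).symm
  rw [SeriesEq] at h ⊢
  set V := Polynomial.aeval (shiftOp Q d) W G
  have h2 := congrArg (diagOp Q y) h
  rw [map_sub, diagOp_rescale, diagOp_X_mul] at h2
  have h3 : Polynomial.aeval (shiftOp Q d)
      ((1 + Polynomial.C y * Polynomial.X) * W + Polynomial.C (d * y)) (insertOp Q d y G) =
      insertOp Q d y V + PowerSeries.C y * shiftOp Q d (insertOp Q d y V) +
        PowerSeries.C (d * y) * insertOp Q d y G := by
    simp only [map_add, map_mul, Polynomial.aeval_X, Polynomial.aeval_C,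
      LinearMap.add_apply, Module.End.mul_apply, hc,
      Module.algebraMap_end_apply, PowerSeries.smul_eq_C_mul, add_mul, one_mul, mul_assoc]
  rw [h3, shiftOp_apply, insertOp_apply, insertOp_apply, map_mul, map_mul, map_mul,
    rescale_eulerSeries hQ, map_mul]
  linear_combination ((1 - PowerSeries.C d * PowerSeries.C y * PowerSeries.X) *
    eulerSeries Q (d * y)) * h2

/-! ### Elementary symmetric functions -/

/-- The `k`-th elementary symmetric function of the numbers `y i`, `i ∈ s`. -/
noncomputable def elemSymm (y : ℕ → ℂ) (s : Finset ℕ) (k : ℕ) : ℂ :=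
  ∑ T ∈ s.powersetCard k, ∏ i ∈ T, y i

theorem elemSymm_zero (y : ℕ → ℂ) (s : Finset ℕ) : elemSymm y s 0 = 1 := by
  simp [elemSymm]

theorem elemSymm_card_succ (y : ℕ → ℂ) (s : Finset ℕ) : elemSymm y s (s.card + 1) = 0 := by
  rw [elemSymm, Finset.powersetCard_eq_empty.mpr (Nat.lt_succ_self _), Finset.sum_empty]

theorem prod_one_add_mul_eq_sum_elemSymm {A : Type*} [CommRing A] [Algebra ℂ A] (y : ℕ → ℂ)
    (s : Finset ℕ) (t : A) : ∏ i ∈ s, (1 + algebraMap ℂ A (y i) * t) =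
      ∑ k ∈ Finset.range (s.card + 1), algebraMap ℂ A (elemSymm y s k) * t ^ k := by
  rw [Finset.prod_one_add, Finset.sum_powerset]
  refine Finset.sum_congr rfl fun k _ => ?_
  rw [elemSymm, map_sum, Finset.sum_mul]
  refine Finset.sum_congr rfl fun T hT => ?_
  rw [Finset.prod_mul_distrib, Finset.prod_const, (Finset.mem_powersetCard.mp hT).2, map_prod]

/-- The polynomial `W = E + d (E - 1) / X`, where `E = ∏ (1 + y i X)` over `i ∈ s`. -/
noncomputable def eqPoly (d : ℂ) (y : ℕ → ℂ) (s : Finset ℕ) : Polynomial ℂ :=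
  ∑ k ∈ Finset.range (s.card + 1),
    Polynomial.C (elemSymm y s k + d * elemSymm y s (k + 1)) * Polynomial.X ^ k

/-- The defining relation `X W = (X + d) E - d` of `eqPoly`. -/
theorem X_mul_eqPoly (d : ℂ) (y : ℕ → ℂ) (s : Finset ℕ) :
    Polynomial.X * eqPoly d y s = (Polynomial.X + Polynomial.C d) *
      ∏ i ∈ s, (1 + Polynomial.C (y i) * Polynomial.X) - Polynomial.C d := by
  have h1 := prod_one_add_mul_eq_sum_elemSymm y s (Polynomial.X : Polynomial ℂ)
  simp only [Polynomial.algebraMap_eq] at h1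
  have h2 : ∏ i ∈ s, (1 + Polynomial.C (y i) * Polynomial.X) =
      Polynomial.X * ∑ k ∈ Finset.range (s.card + 1),
        Polynomial.C (elemSymm y s (k + 1)) * Polynomial.X ^ k + 1 := by
    rw [h1, Finset.sum_range_succ', Finset.sum_range_succ _ s.card, elemSymm_card_succ,
      elemSymm_zero]
    simp only [map_zero, zero_mul, add_zero, map_one, pow_zero, mul_one, Finset.mul_sum, pow_succ]
    congr 1
    exact Finset.sum_congr rfl fun k _ => by ring
  have h3 : eqPoly d y s = ∑ k ∈ Finset.range (s.card + 1),
      Polynomial.C (elemSymm y s k) * Polynomial.X ^ k + Polynomial.C d *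
        ∑ k ∈ Finset.range (s.card + 1),
          Polynomial.C (elemSymm y s (k + 1)) * Polynomial.X ^ k := by
    rw [eqPoly, Finset.mul_sum, ← Finset.sum_add_distrib]
    exact Finset.sum_congr rfl fun k _ => by rw [map_add, map_mul]; ring
  rw [h3, ← h1]
  linear_combination -Polynomial.C d * h2

theorem eqPoly_empty (d : ℂ) (y : ℕ → ℂ) : eqPoly d y ∅ = 1 := by
  refine mul_left_cancel₀ Polynomial.X_ne_zero ?_
  rw [X_mul_eqPoly]; simp

theorem eqPoly_insert (d : ℂ) (y : ℕ → ℂ) {s : Finset ℕ} {i : ℕ} (hi : i ∉ s) :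
    eqPoly d y (insert i s) = (1 + Polynomial.C (y i) * Polynomial.X) * eqPoly d y s +
      Polynomial.C (d * y i) := by
  refine mul_left_cancel₀ Polynomial.X_ne_zero ?_
  have h := X_mul_eqPoly d y s
  rw [X_mul_eqPoly, Finset.prod_insert hi, map_mul]
  linear_combination (-(1 + Polynomial.C (y i) * Polynomial.X)) * h

/-! ### Sums of power series in the unit disc -/

/-- The sum of a power series at a complex number. -/
noncomputable def seriesSum (F : PowerSeries ℂ) (x : ℂ) : ℂ :=
  ∑' n, PowerSeries.coeff n F * x ^ n

/-- The series has radius of convergence at least `1`. -/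
def DiscSummable (F : PowerSeries ℂ) : Prop :=
  ∀ x : ℂ, ‖x‖ < 1 → Summable fun n => PowerSeries.coeff n F * x ^ n

theorem discSummable_of_tendsto {F : PowerSeries ℂ} {l : ℂ}
    (h : Filter.Tendsto (fun n => PowerSeries.coeff n F) Filter.atTop (nhds l)) :
    DiscSummable F := by
  intro x hx
  obtain ⟨B, hB⟩ := h.norm.bddAbove_range
  refine Summable.of_norm_bounded
    ((summable_geometric_of_lt_one (norm_nonneg _) hx).mul_left B) fun n => ?_
  rw [norm_mul, norm_pow]
  exact mul_le_mul_of_nonneg_right (hB ⟨n, rfl⟩) (by positivity)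

theorem seriesSum_zero (F : PowerSeries ℂ) : seriesSum F 0 = PowerSeries.coeff 0 F := by
  rw [seriesSum, tsum_eq_single 0 fun n hn => by simp [hn]]
  simp

theorem seriesSum_rescale (F : PowerSeries ℂ) (Q x : ℂ) :
    seriesSum (PowerSeries.rescale Q F) x = seriesSum F (x * Q) := by
  rw [seriesSum, seriesSum]
  exact tsum_congr fun n => by rw [PowerSeries.coeff_rescale]; ring

theorem norm_mul_lt_one {x Q : ℂ} (hx : ‖x‖ < 1) (hQ : ‖Q‖ < 1) : ‖x * Q‖ < 1 := by
  rw [norm_mul]; exact mul_lt_one_of_nonneg_of_lt_one_left (norm_nonneg _) hx hQ.le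

theorem norm_mul_pow_lt_one {x Q : ℂ} (hx : ‖x‖ < 1) (hQ : ‖Q‖ < 1) (k : ℕ) :
    ‖x * Q ^ k‖ < 1 := by
  rw [norm_mul, norm_pow]
  exact mul_lt_one_of_nonneg_of_lt_one_left (norm_nonneg _) hx
    (pow_le_one₀ (norm_nonneg _) hQ.le)

theorem DiscSummable.rescale {F : PowerSeries ℂ} (h : DiscSummable F) {Q : ℂ} (hQ : ‖Q‖ < 1) :
    DiscSummable (PowerSeries.rescale Q F) := fun x hx =>
  (h (x * Q) (norm_mul_lt_one hx hQ)).congr fun n => by rw [PowerSeries.coeff_rescale]; ring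

theorem DiscSummable.hasSum_X_mul {F : PowerSeries ℂ} (h : DiscSummable F) {x : ℂ}
    (hx : ‖x‖ < 1) : HasSum (fun n => PowerSeries.coeff n (PowerSeries.X * F) * x ^ n)
      (x * seriesSum F x) := by
  rw [← hasSum_nat_add_iff' 1]
  simp only [PowerSeries.coeff_succ_X_mul, Finset.range_one, Finset.sum_singleton,
    PowerSeries.coeff_zero_X_mul, zero_mul, sub_zero]
  exact ((h x hx).hasSum.mul_left x).congr_fun fun n => by ring

theorem DiscSummable.X_mul {F : PowerSeries ℂ} (h : DiscSummable F) :
    DiscSummable (PowerSeries.X * F) := fun _ hx => (h.hasSum_X_mul hx).summable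

theorem DiscSummable.seriesSum_X_mul {F : PowerSeries ℂ} (h : DiscSummable F) {x : ℂ}
    (hx : ‖x‖ < 1) : seriesSum (PowerSeries.X * F) x = x * seriesSum F x :=
  (h.hasSum_X_mul hx).tsum_eq

theorem DiscSummable.sub {F G : PowerSeries ℂ} (hF : DiscSummable F) (hG : DiscSummable G) :
    DiscSummable (F - G) := fun x hx =>
  ((hF x hx).sub (hG x hx)).congr fun n => by rw [map_sub]; ring

theorem DiscSummable.seriesSum_sub {F G : PowerSeries ℂ} (hF : DiscSummable F)
    (hG : DiscSummable G) {x : ℂ} (hx : ‖x‖ < 1) :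
    seriesSum (F - G) x = seriesSum F x - seriesSum G x := by
  rw [seriesSum, seriesSum, seriesSum, ← (hF x hx).tsum_sub (hG x hx)]
  exact tsum_congr fun n => by rw [map_sub]; ring

theorem DiscSummable.smul {F : PowerSeries ℂ} (h : DiscSummable F) (c : ℂ) :
    DiscSummable (c • F) := fun x hx =>
  ((h x hx).mul_left c).congr fun n => by simp; ring

theorem seriesSum_smul (F : PowerSeries ℂ) (c x : ℂ) : seriesSum (c • F) x = c * seriesSum F x := by
  rw [seriesSum, seriesSum, ← tsum_mul_left]
  exact tsum_congr fun n => by simp; ring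

theorem DiscSummable.sum {ι : Type*} (s : Finset ι) {F : ι → PowerSeries ℂ}
    (h : ∀ i ∈ s, DiscSummable (F i)) :
    DiscSummable (∑ i ∈ s, F i) ∧
      ∀ x : ℂ, ‖x‖ < 1 → seriesSum (∑ i ∈ s, F i) x = ∑ i ∈ s, seriesSum (F i) x := by
  constructor
  · intro x hx
    exact (summable_sum fun i hi => h i hi x hx).congr fun n => by
      simp [Finset.sum_mul]
  · intro x hx
    simp only [seriesSum]
    rw [← Summable.tsum_finsetSum fun i hi => h i hi x hx]
    exact tsum_congr fun n => by simp [Finset.sum_mul]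

theorem DiscSummable.continuousOn {F : PowerSeries ℂ} (h : DiscSummable F) :
    ContinuousOn (seriesSum F) (Metric.ball 0 1) := by
  refine continuousOn_of_forall_continuousAt fun x hx => ?_
  rw [mem_ball_zero_iff] at hx
  obtain ⟨ρ, h1, h2⟩ := exists_between hx
  have h0 : 0 ≤ ρ := (norm_nonneg _).trans h1.le
  have hs := (h (ρ : ℂ) (by simpa [abs_of_nonneg h0] using h2)).norm
  have : ContinuousOn (seriesSum F) (Metric.ball 0 ρ) := by
    refine continuousOn_tsum (fun n => by fun_prop) hs fun n z hz => ?_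
    rw [mem_ball_zero_iff] at hz
    rw [norm_mul, norm_mul, norm_pow, norm_pow, Complex.norm_real, Real.norm_of_nonneg h0]
    gcongr
  exact this.continuousAt (Metric.isOpen_ball.mem_nhds (by simpa using h1))

theorem DiscSummable.shiftOp {F : PowerSeries ℂ} (h : DiscSummable F) {Q : ℂ} (hQ : ‖Q‖ < 1)
    (d : ℂ) : DiscSummable (shiftOp Q d F) :=
  (h.rescale hQ).sub (h.X_mul.smul d)

theorem DiscSummable.seriesSum_shiftOp {F : PowerSeries ℂ} (h : DiscSummable F) {Q : ℂ}
    (hQ : ‖Q‖ < 1) (d : ℂ) {x : ℂ} (hx : ‖x‖ < 1) :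
    seriesSum (_root_.shiftOp Q d F) x = seriesSum F (x * Q) - d * x * seriesSum F x := by
  have : _root_.shiftOp Q d F = PowerSeries.rescale Q F - d • (PowerSeries.X * F) := rfl
  rw [this, (h.rescale hQ).seriesSum_sub (h.X_mul.smul d) hx, seriesSum_rescale, seriesSum_smul,
    h.seriesSum_X_mul hx, mul_assoc]

/-! ### `q`-binomial coefficients -/

theorem qBinom_natCast {Q : ℂ} {m r : ℕ} (h : r ≤ m) : qBinom Q m r =
    (∏ i ∈ Finset.range r, (1 - Q ^ (m - i))) / ∏ i ∈ Finset.range r, (1 - Q ^ (i + 1)) := by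
  simp [qBinom, h]

theorem qBinom_of_lt {Q : ℂ} {m r : ℤ} (h : m < r) : qBinom Q m r = 0 :=
  if_neg fun h' => by omega

theorem qBinom_of_neg {Q : ℂ} {m r : ℤ} (h : r < 0) : qBinom Q m r = 0 :=
  if_neg fun h' => by omega

theorem qBinom_zero_right (Q : ℂ) (m : ℕ) : qBinom Q m 0 = 1 := by
  simp [qBinom]

theorem qBinom_self {Q : ℂ} (hQ : ‖Q‖ < 1) (m : ℕ) : qBinom Q m m = 1 := by
  rw [qBinom_natCast le_rfl, ← Finset.prod_range_reflect]
  rw [div_eq_one_iff_eq (prod_one_sub_pow_ne_zero hQ m)]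
  refine Finset.prod_congr rfl fun i hi => ?_
  rw [Finset.mem_range] at hi
  congr 2; omega

/-- The Pascal rule for `q`-binomial coefficients. -/
theorem qBinom_succ_succ {Q : ℂ} (hQ : ‖Q‖ < 1) {k m : ℕ} (h : m ≤ k) :
    qBinom Q ((k + 1 : ℕ) : ℤ) ((m + 1 : ℕ) : ℤ) =
      qBinom Q k ((m + 1 : ℕ) : ℤ) + Q ^ (k - m) * qBinom Q k m := by
  rcases h.eq_or_lt with rfl | h'
  · rw [qBinom_self hQ, qBinom_self hQ, qBinom_of_lt (by omega)]; simp
  · rw [qBinom_natCast (by omega), qBinom_natCast (by omega), qBinom_natCast h,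
      Finset.prod_range_succ', Finset.prod_range_succ _ m, Finset.prod_range_succ _ m]
    have h1 := one_sub_pow_ne_zero hQ m
    have h2 := prod_one_sub_pow_ne_zero hQ m
    have h3 : Q ^ (k + 1) = Q ^ (k - m) * Q ^ (m + 1) := by rw [← pow_add]; congr 1; omega
    simp only [Nat.add_sub_add_right, Nat.sub_zero]
    rw [h3]
    field_simp
    ring

/-- The `q`-binomial theorem for the powers of `U = η - d X`, in terms of sums of series. -/
theorem DiscSummable.seriesSum_shiftOp_pow {Q : ℂ} (hQ : ‖Q‖ < 1) (d : ℂ) (k : ℕ) :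
    ∀ {F : PowerSeries ℂ}, DiscSummable F → DiscSummable ((_root_.shiftOp Q d ^ k) F) ∧
      ∀ x : ℂ, ‖x‖ < 1 → seriesSum ((_root_.shiftOp Q d ^ k) F) x =
        ∑ m ∈ Finset.range (k + 1), qBinom Q k m * (-d * x) ^ m * seriesSum F (x * Q ^ (k - m)) := by
  induction k with
  | zero =>
    intro F h
    refine ⟨by simpa using h, fun x hx => ?_⟩
    simp [qBinom]
  | succ k ih =>
    intro F h
    obtain ⟨h1, h2⟩ := ih (h.shiftOp hQ d)
    rw [pow_succ, Module.End.mul_apply]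
    refine ⟨h1, fun x hx => ?_⟩
    have e1 : ∀ m ∈ Finset.range (k + 1),
        qBinom Q k m * (-d * x) ^ m * seriesSum (_root_.shiftOp Q d F) (x * Q ^ (k - m)) =
        qBinom Q k m * (-d * x) ^ m * seriesSum F (x * Q ^ (k + 1 - m)) +
        Q ^ (k - m) * qBinom Q k m * (-d * x) ^ (m + 1) *
          seriesSum F (x * Q ^ (k + 1 - (m + 1))) := by
      intro m hm
      rw [Finset.mem_range] at hm
      rw [h.seriesSum_shiftOp hQ d (norm_mul_pow_lt_one hx hQ _), mul_assoc x, ← pow_succ,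
        show k - m + 1 = k + 1 - m by omega, Nat.add_sub_add_right]
      ring
    rw [h2 x hx, Finset.sum_congr rfl e1, Finset.sum_add_distrib,
      Finset.sum_range_succ' _ (k + 1)]
    have e2 : ∀ m ∈ Finset.range (k + 1), qBinom Q ((k + 1 : ℕ) : ℤ) ((m + 1 : ℕ) : ℤ) *
        (-d * x) ^ (m + 1) * seriesSum F (x * Q ^ (k + 1 - (m + 1))) =
        qBinom Q k ((m + 1 : ℕ) : ℤ) * (-d * x) ^ (m + 1) *
          seriesSum F (x * Q ^ (k + 1 - (m + 1))) +
        Q ^ (k - m) * qBinom Q k m * (-d * x) ^ (m + 1) *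
          seriesSum F (x * Q ^ (k + 1 - (m + 1))) := by
      intro m hm
      rw [Finset.mem_range] at hm
      rw [qBinom_succ_succ hQ (by omega)]
      ring
    rw [Finset.sum_congr rfl e2, Finset.sum_add_distrib]
    have e3 := Finset.sum_range_succ' (fun m => qBinom Q k m * (-d * x) ^ m *
      seriesSum F (x * Q ^ (k + 1 - m))) (k + 1)
    rw [Finset.sum_range_succ, qBinom_of_lt (by omega : (k : ℤ) < ((k + 1 : ℕ) : ℤ))] at e3
    simp only [Nat.cast_zero, qBinom_zero_right] at e3 ⊢
    linear_combination e3

/-- The equation `(1 - η) F = X W(U) F`, evaluated at a point of the unit disc. -/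
theorem SeriesEq.seriesSum_eq {Q : ℂ} (hQ : ‖Q‖ < 1) {d : ℂ} {y : ℕ → ℂ} {s : Finset ℕ}
    {F : PowerSeries ℂ} (hF : DiscSummable F) (h : SeriesEq Q d (eqPoly d y s) F) {x : ℂ}
    (hx : ‖x‖ < 1) : seriesSum F x - seriesSum F (x * Q) =
      x * ∑ k ∈ Finset.range (s.card + 1), (elemSymm y s k + d * elemSymm y s (k + 1)) *
        ∑ m ∈ Finset.range (k + 1), qBinom Q k m * (-d * x) ^ m * seriesSum F (x * Q ^ (k - m)) := by
  have e : Polynomial.aeval (shiftOp Q d) (eqPoly d y s) F =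
      ∑ k ∈ Finset.range (s.card + 1),
        (elemSymm y s k + d * elemSymm y s (k + 1)) • (shiftOp Q d ^ k) F := by
    simp only [eqPoly, map_sum, map_mul, Polynomial.aeval_C, Polynomial.aeval_X, map_pow,
      LinearMap.sum_apply, Module.End.mul_apply, Module.algebraMap_end_apply]
  have hs : ∀ k ∈ Finset.range (s.card + 1), DiscSummable
      ((elemSymm y s k + d * elemSymm y s (k + 1)) • (shiftOp Q d ^ k) F) :=
    fun k _ => (DiscSummable.seriesSum_shiftOp_pow hQ d k hF).1.smul _
  have h1 := congrArg (fun G => seriesSum G x) h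
  rw [hF.seriesSum_sub (hF.rescale hQ) hx, seriesSum_rescale, e,
    (DiscSummable.sum _ hs).1.seriesSum_X_mul hx, (DiscSummable.sum _ hs).2 x hx] at h1
  rw [h1]
  congr 1
  refine Finset.sum_congr rfl fun k _ => ?_
  rw [seriesSum_smul, (DiscSummable.seriesSum_shiftOp_pow hQ d k hF).2 x hx]

/-! ### The functional equation of the sum of the series -/

@[to_additive]
theorem prod_Icc_eq_prod_range {M : Type*} [CommMonoid M] (f : ℕ → M) (r : ℕ) :
    ∏ j ∈ Finset.Icc 1 r, f j = ∏ j ∈ Finset.range r, f (j + 1) := by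
  induction r with
  | zero => simp
  | succ r ih => rw [Finset.prod_Icc_succ_top (by omega), Finset.prod_range_succ, ih]

/-- The inner sum of the `q`-difference equation, `e k` standing for the `k`-th elementary
symmetric function of the numbers `q ^ a i`, and `Q` for `q ^ N`. A factor `x` is left out; the
natural subtraction in the exponent is harmless, the `q`-binomial coefficient next to it being zero
for `m = 0`. -/
noncomputable def eqCoeff (Q d : ℂ) (e : ℕ → ℂ) (r j : ℕ) (x : ℂ) : ℂ :=
  ∑ m ∈ Finset.range (r - j + 1), d ^ m * e (j + m) *
    ((-x) ^ (m - 1) * qBinom Q ((j : ℤ) + m - 1) ((m : ℤ) - 1) +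
      (-x) ^ m * qBinom Q ((j : ℤ) + m) m)

/-- Rearrangement of the double sum coming from the `q`-binomial theorem into the one of the
`q`-difference equation. -/
theorem functional_eq_of_binomial_sum {Q : ℂ} (hQ : ‖Q‖ < 1) (d x : ℂ) (e Φ : ℕ → ℂ) (r : ℕ)
    (he0 : e 0 = 1) (he : e (r + 1) = 0)
    (h : Φ 0 - Φ 1 = x * ∑ k ∈ Finset.range (r + 1), (e k + d * e (k + 1)) *
        ∑ m ∈ Finset.range (k + 1), qBinom Q k m * (-d * x) ^ m * Φ (k - m)) :
    (1 - x) * (∑ k ∈ Finset.range (r + 1), e k * (-d * x) ^ k) * Φ 0 =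
      Φ 1 + ∑ j ∈ Finset.Icc 1 r, x * eqCoeff Q d e r j x * Φ j := by
  set B : ℕ → ℕ → ℂ := fun k m => qBinom Q ((k : ℤ) - 1) ((m : ℤ) - 1)
  have hB0 : ∀ k, B k 0 = 0 := fun k => qBinom_of_neg (by simp)
  have hBs : ∀ k m, B (k + 1) (m + 1) = qBinom Q k m := fun k m => by simp [B]
  -- the part of the sum with `d * e (k + 1)`, after the shift `(k, m) ↦ (k + 1, m + 1)`
  have h1 : x * ∑ k ∈ Finset.range (r + 1), d * e (k + 1) *
        ∑ m ∈ Finset.range (k + 1), qBinom Q k m * (-d * x) ^ m * Φ (k - m) =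
      -∑ k ∈ Finset.range (r + 1), ∑ m ∈ Finset.range (k + 1),
        e k * B k m * (-d * x) ^ m * Φ (k - m) := by
    rw [Finset.sum_range_succ _ r, he, Finset.sum_range_succ'
      (fun k => ∑ m ∈ Finset.range (k + 1), e k * B k m * (-d * x) ^ m * Φ (k - m)) r]
    simp only [mul_zero, zero_mul, add_zero, zero_add, Finset.range_one, Finset.sum_singleton,
      hB0, Finset.sum_const_zero, Finset.mul_sum, ← Finset.sum_neg_distrib]
    refine Finset.sum_congr rfl fun k _ => ?_
    rw [Finset.sum_range_succ' _ (k + 1)]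
    simp only [hB0, hBs, mul_zero, zero_mul, neg_zero, add_zero, Nat.add_sub_add_right]
    exact Finset.sum_congr rfl fun m _ => by ring
  set t : ℕ → ℕ → ℂ := fun j m =>
    e (j + m) * (-d * x) ^ m * (x * qBinom Q ((j : ℤ) + m) m - B (j + m) m) * Φ j
  have h2 : Φ 0 - Φ 1 = ∑ j ∈ Finset.range (r + 1), ∑ m ∈ Finset.range (r + 1 - j), t j m := by
    rw [← Finset.sum_range_diag_flip, h]
    simp only [add_mul, Finset.sum_add_distrib, mul_add]
    rw [h1, Finset.mul_sum, ← sub_eq_add_neg, ← Finset.sum_sub_distrib]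
    refine Finset.sum_congr rfl fun k _ => ?_
    rw [← Finset.sum_flip (fun j => t j (k - j)), Finset.mul_sum, Finset.mul_sum, ← Finset.sum_sub_distrib]
    refine Finset.sum_congr rfl fun m hm => ?_
    have hm' : m ≤ k := Nat.lt_succ_iff.mp (Finset.mem_range.mp hm)
    simp only [t, Nat.sub_sub_self hm', Nat.sub_add_cancel hm']
    rw [show ((k - m : ℕ) : ℤ) + m = k by omega]
    ring
  have h3 : ∑ m ∈ Finset.range (r + 1 - 0), t 0 m =
      (x - 1) * (∑ k ∈ Finset.range (r + 1), e k * (-d * x) ^ k) * Φ 0 + Φ 0 := by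
    rw [Nat.sub_zero, Finset.sum_range_succ' _ r, Finset.sum_range_succ' _ r, mul_add, add_mul,
      Finset.mul_sum, Finset.sum_mul]
    have : ∀ m ∈ Finset.range r, t 0 (m + 1) = (x - 1) * (e (m + 1) * (-d * x) ^ (m + 1)) * Φ 0 := by
      intro m _
      have := qBinom_self hQ (m + 1)
      simp only [t, zero_add, hBs, qBinom_self hQ m, Nat.cast_zero, this]
      ring
    rw [Finset.sum_congr rfl this]
    simp only [t, hB0, add_zero, he0, pow_zero, Nat.cast_zero]
    have := qBinom_zero_right Q 0
    simp only [Nat.cast_zero] at this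
    rw [this]
    ring
  have h4 : ∀ j, x * eqCoeff Q d e r j x * Φ j = ∑ m ∈ Finset.range (r - j + 1), t j m := by
    intro j
    rw [eqCoeff, Finset.mul_sum, Finset.sum_mul]
    refine Finset.sum_congr rfl fun m _ => ?_
    simp only [t]
    rcases m with _ | m
    · -- `B` and the term with the truncated exponent both vanish for `m = 0`
      rw [hB0, qBinom_of_neg (by simp : ((0 : ℕ) : ℤ) - 1 < 0)]; ring
    · simp only [B, Nat.add_sub_cancel]
      rw [show ((j + (m + 1) : ℕ) : ℤ) = (j : ℤ) + ((m + 1 : ℕ) : ℤ) by push_cast; ring,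
        show (-d * x) ^ (m + 1) = d ^ (m + 1) * ((-x) ^ m * -x) by
          rw [← pow_succ, ← mul_pow]; congr 1; ring, pow_succ (-x) m]
      generalize (-x) ^ m = w
      ring
  rw [Finset.sum_range_succ', h3] at h2
  simp only [h4]
  rw [sum_Icc_eq_sum_range]
  have h5 : ∀ j ∈ Finset.range r, ∑ m ∈ Finset.range (r - (j + 1) + 1), t (j + 1) m =
      ∑ m ∈ Finset.range (r + 1 - (j + 1)), t (j + 1) m := by
    intro j hj
    rw [Finset.mem_range] at hj
    rw [show r - (j + 1) + 1 = r + 1 - (j + 1) by omega]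
  rw [Finset.sum_congr rfl h5]
  linear_combination h2

/-! ### The solution in power series and the limit of its coefficients -/

theorem qPochInf_ne_zero {b Q : ℂ} (hb : ‖b‖ < 1) (hQ : ‖Q‖ < 1) : qPochInf b Q ≠ 0 := by
  have h1 : Summable fun n : ℕ => ‖-(b * Q ^ n)‖ := by
    simp only [norm_neg, norm_mul, norm_pow]
    exact (summable_geometric_of_lt_one (norm_nonneg _) hQ).mul_left _
  have h2 : ∀ n : ℕ, 1 + -(b * Q ^ n) ≠ 0 := by
    intro n h
    have h3 := norm_mul_pow_lt_one hb hQ n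
    rw [show b * Q ^ n = 1 by linear_combination -h, norm_one] at h3
    exact h3.false
  simpa [qPochInf, sub_eq_add_neg] using tprod_one_add_ne_zero_of_summable h2 h1

theorem tendsto_prod_qPochInf (b : ℂ) {Q : ℂ} (hQ : ‖Q‖ < 1) : Filter.Tendsto
    (fun n => ∏ k ∈ Finset.range n, (1 - b * Q ^ k)) Filter.atTop (nhds (qPochInf b Q)) :=
  (multipliable_qPochInf b Q hQ).tendsto_prod_tprod_nat

theorem tendsto_coeff_eulerSeries {Q : ℂ} (hQ : ‖Q‖ < 1) : Filter.Tendsto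
    (fun n => PowerSeries.coeff n (eulerSeries Q 1)) Filter.atTop (nhds (qPochInf Q Q)⁻¹) := by
  refine ((tendsto_prod_qPochInf Q hQ).inv₀ (qPochInf_ne_zero hQ hQ)).congr fun n => ?_
  simp [eulerSeries, pow_succ']

theorem discSummable_eulerSeries {Q : ℂ} (hQ : ‖Q‖ < 1) : DiscSummable (eulerSeries Q 1) :=
  discSummable_of_tendsto (tendsto_coeff_eulerSeries hQ)

theorem seriesSum_eulerSeries_mul {Q : ℂ} (hQ : ‖Q‖ < 1) {x : ℂ} (hx : ‖x‖ < 1) :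
    seriesSum (eulerSeries Q 1) (x * Q) = (1 - x) * seriesSum (eulerSeries Q 1) x := by
  have h := discSummable_eulerSeries hQ
  have h1 := rescale_eulerSeries hQ 1
  rw [map_one, one_mul, sub_mul, one_mul] at h1
  rw [← seriesSum_rescale, h1, h.seriesSum_sub h.X_mul hx, h.seriesSum_X_mul hx]
  ring

theorem seriesSum_eulerSeries_mul_pow {Q : ℂ} (hQ : ‖Q‖ < 1) {x : ℂ} (hx : ‖x‖ < 1) (n : ℕ) :
    seriesSum (eulerSeries Q 1) (x * Q ^ n) =
      (∏ k ∈ Finset.range n, (1 - x * Q ^ k)) * seriesSum (eulerSeries Q 1) x := by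
  induction n with
  | zero => simp
  | succ n ih =>
    rw [pow_succ, ← mul_assoc, seriesSum_eulerSeries_mul hQ (norm_mul_pow_lt_one hx hQ n), ih,
      Finset.prod_range_succ]
    ring

theorem DiscSummable.continuousAt {F : PowerSeries ℂ} (h : DiscSummable F) {x : ℂ}
    (hx : ‖x‖ < 1) : ContinuousAt (seriesSum F) x :=
  h.continuousOn.continuousAt (Metric.isOpen_ball.mem_nhds (by simpa using hx))

/-- Euler's identity `∑ z ^ n / ((1 - Q) ⋯ (1 - Q ^ n)) = 1 / (z; Q)_∞`. -/
theorem seriesSum_eulerSeries {Q : ℂ} (hQ : ‖Q‖ < 1) {z : ℂ} (hz : ‖z‖ < 1) :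
    seriesSum (eulerSeries Q 1) z = (qPochInf z Q)⁻¹ := by
  have h0 : Filter.Tendsto (fun n : ℕ => z * Q ^ n) Filter.atTop (nhds 0) := by
    simpa using (tendsto_pow_atTop_nhds_zero_of_norm_lt_one hQ).const_mul z
  have h1 := ((discSummable_eulerSeries hQ).continuousAt (x := 0) (by simp)).tendsto.comp h0
  rw [seriesSum_zero, coeff_zero_eulerSeries] at h1
  have h2 := (tendsto_prod_qPochInf z hQ).mul_const (seriesSum (eulerSeries Q 1) z)
  have h3 := tendsto_nhds_unique h1 (h2.congr fun n => (seriesSum_eulerSeries_mul_pow hQ hz n).symm)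
  exact eq_inv_of_mul_eq_one_right h3.symm

/-- The coefficients of a product converge if one factor is absolutely summable at `1` and the
coefficients of the other one converge. -/
theorem tendsto_coeff_mul {c H : PowerSeries ℂ} {l : ℂ}
    (hc : Summable fun n => ‖PowerSeries.coeff n c‖)
    (hH : Filter.Tendsto (fun n => PowerSeries.coeff n H) Filter.atTop (nhds l)) :
    Filter.Tendsto (fun n => PowerSeries.coeff n (c * H)) Filter.atTop
      (nhds ((∑' n, PowerSeries.coeff n c) * l)) := by
  obtain ⟨B, hB⟩ := hH.norm.bddAbove_range
  have hB0 : 0 ≤ B := (norm_nonneg _).trans (hB ⟨0, rfl⟩)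
  have h := tendsto_tsum_of_dominated_convergence (𝓕 := Filter.atTop)
    (f := fun n k => if k ∈ Finset.range (n + 1) then
      PowerSeries.coeff k c * PowerSeries.coeff (n - k) H else 0)
    (g := fun k => PowerSeries.coeff k c * l) (hc.mul_right B) ?_ ?_
  · rw [tsum_mul_right] at h
    refine h.congr fun n => ?_
    rw [PowerSeries.coeff_mul, Finset.Nat.sum_antidiagonal_eq_sum_range_succ_mk,
      tsum_eq_sum (s := Finset.range (n + 1)) fun k hk => if_neg hk]
    exact Finset.sum_congr rfl fun k hk => if_pos hk
  · intro k
    refine ((hH.comp (Filter.tendsto_sub_atTop_nat k)).const_mul _).congr' ?_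
    filter_upwards [Filter.eventually_ge_atTop k] with n hn
    rw [if_pos (Finset.mem_range.mpr (by omega))]
    rfl
  · refine Filter.Eventually.of_forall fun n k => ?_
    split_ifs
    · rw [norm_mul]
      exact mul_le_mul_of_nonneg_left (hB ⟨_, rfl⟩) (norm_nonneg _)
    · rw [norm_zero]; positivity

theorem tendsto_coeff_insertOp {Q d y l : ℂ} (hQ : ‖Q‖ < 1) (hy : ‖d * y‖ < 1)
    {G : PowerSeries ℂ}
    (h : Filter.Tendsto (fun n => PowerSeries.coeff n G) Filter.atTop (nhds l)) :
    Filter.Tendsto (fun n => PowerSeries.coeff n (insertOp Q d y G)) Filter.atTop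
      (nhds (qPochInf (-y) Q / qPochInf (d * y) Q * l)) := by
  have h1 : Filter.Tendsto (fun n => PowerSeries.coeff n (diagOp Q y G)) Filter.atTop
      (nhds (qPochInf (-y) Q * l)) :=
    ((tendsto_prod_qPochInf (-y) hQ).mul h).congr fun n => by
      rw [coeff_diagOp]; simp
  have h2 := (discSummable_eulerSeries hQ (d * y) hy).norm
  simp only [← coeff_eulerSeries] at h2
  have h3 := tendsto_coeff_mul h2 h1
  have h4 : ∑' n, PowerSeries.coeff n (eulerSeries Q (d * y)) = (qPochInf (d * y) Q)⁻¹ := by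
    rw [← seriesSum_eulerSeries hQ hy]
    exact tsum_congr fun n => coeff_eulerSeries Q _ n
  rw [h4] at h3
  rwa [div_eq_inv_mul, mul_assoc]

/-- The power series solution with constant coefficient `1`, together with the limit of its
coefficients. -/
theorem exists_seriesEq {Q d : ℂ} (hQ : ‖Q‖ < 1) (y : ℕ → ℂ) (s : Finset ℕ)
    (hy : ∀ i ∈ s, ‖d * y i‖ < 1) :
    ∃ F : PowerSeries ℂ, PowerSeries.coeff 0 F = 1 ∧ SeriesEq Q d (eqPoly d y s) F ∧
      Filter.Tendsto (fun n => PowerSeries.coeff n F) Filter.atTop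
        (nhds ((∏ i ∈ s, qPochInf (-y i) Q / qPochInf (d * y i) Q) * (qPochInf Q Q)⁻¹)) := by
  induction s using Finset.induction_on with
  | empty =>
    refine ⟨eulerSeries Q 1, coeff_zero_eulerSeries Q 1, ?_, ?_⟩
    · rw [eqPoly_empty]; exact seriesEq_one hQ d
    · simpa using tendsto_coeff_eulerSeries hQ
  | insert i s hi ih =>
    obtain ⟨G, h0, h1, h2⟩ := ih fun j hj => hy j (Finset.mem_insert_of_mem hj)
    refine ⟨insertOp Q d (y i) G, ?_, ?_, ?_⟩
    · have := coeff_zero_eulerSeries Q (d * y i)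
      rw [insertOp_apply, PowerSeries.coeff_zero_eq_constantCoeff_apply, map_mul,
        ← PowerSeries.coeff_zero_eq_constantCoeff_apply,
        ← PowerSeries.coeff_zero_eq_constantCoeff_apply, this, coeff_diagOp, h0]
      simp
    · rw [eqPoly_insert d y hi]; exact h1.insert hQ (y i)
    · rw [Finset.prod_insert hi, mul_assoc]
      exact tendsto_coeff_insertOp hQ (hy i (Finset.mem_insert_self _ _)) h2

/-- **Abel's theorem** in the form: if the coefficients of `F` tend to `l`, then `(1 - t) F(t)`
tends to `l` as `t` increases to `1`. -/
theorem tendsto_one_sub_mul_seriesSum {F : PowerSeries ℂ} {l : ℂ}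
    (h : Filter.Tendsto (fun n => PowerSeries.coeff n F) Filter.atTop (nhds l)) :
    Filter.Tendsto (fun t : ℝ => (1 - (t : ℂ)) * seriesSum F t) (nhdsWithin 1 (Set.Iio 1))
      (nhds l) := by
  have hF := discSummable_of_tendsto h
  have hsum : ∀ n, ∑ i ∈ Finset.range (n + 1),
      PowerSeries.coeff i (F - PowerSeries.X * F) = PowerSeries.coeff n F := by
    intro n
    induction n with
    | zero => simp
    | succ n ih => rw [Finset.sum_range_succ, ih, map_sub, PowerSeries.coeff_succ_X_mul]; ring
  have h1 : Filter.Tendsto (fun n => ∑ i ∈ Finset.range n,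
      PowerSeries.coeff i (F - PowerSeries.X * F)) Filter.atTop (nhds l) := by
    rw [← Filter.tendsto_add_atTop_iff_nat 1]
    exact h.congr fun n => (hsum n).symm
  have h2 := Filter.tendsto_map'_iff.mp (Complex.tendsto_tsum_powerSeries_nhdsWithin_lt h1)
  refine h2.congr' ?_
  filter_upwards [Ioo_mem_nhdsLT (show (0 : ℝ) < 1 by norm_num)] with t ht
  have ht' : ‖(t : ℂ)‖ < 1 := by
    rw [Complex.norm_real, Real.norm_of_nonneg ht.1.le]; exact ht.2
  have := hF.seriesSum_sub hF.X_mul ht'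
  rw [hF.seriesSum_X_mul ht'] at this
  rw [Function.comp_apply]
  exact this.trans (by ring)

/-! ### Uniqueness of the solution -/

/-- A function that is small near `0` and is dominated at `x`, up to a factor `exp (K ‖x‖)`, by its
values at `x Q ^ j`, `j ≥ 1`, vanishes on the unit disc: the factors collected along the orbit of `x`
multiply to at most `exp (K ‖x‖ / (1 - ‖Q‖))`. -/
theorem eq_zero_of_dominated {Q : ℂ} (hQ : ‖Q‖ < 1) {g : ℂ → ℂ} {K : ℝ}
    (hg0 : Filter.Tendsto g (nhds 0) (nhds 0))
    (hg : ∀ x : ℂ, ‖x‖ < 1 → ∀ M : ℝ, (∀ j : ℕ, 1 ≤ j → ‖g (x * Q ^ j)‖ ≤ M) →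
      ‖g x‖ ≤ Real.exp (K * ‖x‖) * M) (hK : 0 ≤ K) {x : ℂ} (hx : ‖x‖ < 1) : g x = 0 := by
  have hQ' : 0 < 1 - ‖Q‖ := by linarith
  have key : ∀ ε > 0, ‖g x‖ ≤ ε * Real.exp (K * ‖x‖ / (1 - ‖Q‖)) := by
    intro ε hε
    obtain ⟨δ, hδ, hgδ⟩ := Metric.tendsto_nhds_nhds.mp hg0 ε hε
    have hind : ∀ n : ℕ, ∀ z : ℂ, ‖z‖ < 1 → ‖z‖ * ‖Q‖ ^ n < δ →
        ‖g z‖ ≤ ε * Real.exp (K * ‖z‖ / (1 - ‖Q‖)) := by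
      intro n
      induction n with
      | zero =>
        intro z _ hz
        have h1 : ‖g z‖ < ε := by simpa using hgδ (by simpa using hz)
        refine h1.le.trans (le_mul_of_one_le_right hε.le (Real.one_le_exp (by positivity)))
      | succ n ih =>
        intro z hz1 hz
        refine (hg z hz1 (ε * Real.exp (K * (‖z‖ * ‖Q‖) / (1 - ‖Q‖))) fun j hj => ?_).trans_eq ?_
        · have hj' : ‖z * Q ^ j‖ ≤ ‖z‖ * ‖Q‖ := by
            rw [norm_mul, norm_pow]
            exact mul_le_mul_of_nonneg_left
              (pow_le_of_le_one (norm_nonneg _) hQ.le (by omega)) (norm_nonneg _)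
          refine (ih _ (norm_mul_pow_lt_one hz1 hQ j) (lt_of_le_of_lt ?_ hz)).trans ?_
          · rw [pow_succ', ← mul_assoc]
            exact mul_le_mul_of_nonneg_right hj' (by positivity)
          · gcongr
        · rw [mul_left_comm, ← Real.exp_add]
          congr 2
          field_simp
          ring
    have h0 : Filter.Tendsto (fun n : ℕ => ‖x‖ * ‖Q‖ ^ n) Filter.atTop (nhds 0) := by
      simpa using (tendsto_pow_atTop_nhds_zero_of_lt_one (norm_nonneg _) hQ).const_mul ‖x‖
    obtain ⟨n, hn⟩ := (h0.eventually_lt_const hδ).exists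
    exact hind n x hx hn
  rw [← norm_le_zero_iff]
  refine le_of_forall_pos_le_add fun ε hε => ?_
  have hE := Real.exp_pos (K * ‖x‖ / (1 - ‖Q‖))
  have := key (ε / Real.exp (K * ‖x‖ / (1 - ‖Q‖))) (by positivity)
  rw [div_mul_cancel₀ _ hE.ne'] at this
  simpa using this

/-- Lower bound for the product on the left of the `q`-difference equation. -/
theorem one_le_norm_prod_mul_exp {d : ℂ} (hd : ‖d‖ < 1) (y : ℕ → ℂ) (s : Finset ℕ)
    (hy : ∀ i ∈ s, ‖y i‖ ≤ 1) {x : ℂ} (hx : ‖x‖ ≤ 1) :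
    1 ≤ ‖∏ i ∈ s, (1 - d * x * y i)‖ * Real.exp (s.card * (‖d‖ / (1 - ‖d‖)) * ‖x‖) := by
  have hd' : 0 < 1 - ‖d‖ := by linarith
  set κ := ‖d‖ / (1 - ‖d‖) with hκ
  have hκ0 : 0 ≤ κ := by positivity
  have hκ1 : κ * (1 - ‖d‖) = ‖d‖ := div_mul_cancel₀ _ hd'.ne'
  have h1 : ∀ i ∈ s, 1 ≤ ‖1 - d * x * y i‖ * Real.exp (κ * ‖x‖) := by
    intro i hi
    have e1 : 1 - ‖d‖ * ‖x‖ ≤ ‖1 - d * x * y i‖ := by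
      have := norm_sub_norm_le (1 : ℂ) (d * x * y i)
      rw [norm_one, norm_mul, norm_mul] at this
      have h2 : ‖d‖ * ‖x‖ * ‖y i‖ ≤ ‖d‖ * ‖x‖ := mul_le_of_le_one_right (by positivity) (hy i hi)
      linarith
    have e2 : 1 + κ * ‖x‖ ≤ Real.exp (κ * ‖x‖) := by linarith [Real.add_one_le_exp (κ * ‖x‖)]
    have e3 : 0 ≤ 1 - ‖d‖ * ‖x‖ := by
      linarith [mul_le_one₀ hd.le (norm_nonneg x) hx]
    have e4 : 1 ≤ (1 - ‖d‖ * ‖x‖) * (1 + κ * ‖x‖) := by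
      have : 0 ≤ ‖d‖ * κ * ‖x‖ * (1 - ‖x‖) :=
        mul_nonneg (by positivity) (by linarith)
      linear_combination this - ‖x‖ * hκ1
    exact e4.trans (mul_le_mul e1 e2 (by positivity) (norm_nonneg _))
  have h2 := Finset.prod_le_prod (s := s) (f := fun _ => (1 : ℝ)) (fun _ _ => zero_le_one) h1
  rw [Finset.prod_const_one, Finset.prod_mul_distrib, Finset.prod_const, ← Real.exp_nat_mul] at h2
  rwa [norm_prod, mul_assoc]

/-! ### The value at `1` -/

/-- The right-hand side of the `q`-difference equation is `f (x Q)` plus a combination of the values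
`f (x Q ^ j)` with these coefficients. -/
noncomputable def eqTerm (Q d : ℂ) (e : ℕ → ℂ) (r j : ℕ) (x : ℂ) : ℂ :=
  x * eqCoeff Q d e r j x * ∏ h ∈ Finset.Icc 1 (j - 1), (1 - x * Q ^ h)

theorem continuous_eqCoeff (Q d : ℂ) (e : ℕ → ℂ) (r j : ℕ) : Continuous (eqCoeff Q d e r j) := by
  unfold eqCoeff; fun_prop

theorem continuous_eqTerm (Q d : ℂ) (e : ℕ → ℂ) (r j : ℕ) : Continuous (eqTerm Q d e r j) := by
  have := continuous_eqCoeff Q d e r j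
  unfold eqTerm; fun_prop

theorem exists_norm_eqTerm_le (Q d : ℂ) (e : ℕ → ℂ) (r : ℕ) : ∃ B : ℝ, 0 ≤ B ∧
    ∀ x : ℂ, ‖x‖ ≤ 1 → ∑ j ∈ Finset.Icc 1 r, ‖eqTerm Q d e r j x‖ ≤ B * ‖x‖ := by
  have hc : Continuous fun x : ℂ => ∑ j ∈ Finset.Icc 1 r,
      ‖eqCoeff Q d e r j x * ∏ h ∈ Finset.Icc 1 (j - 1), (1 - x * Q ^ h)‖ := by
    have := continuous_eqCoeff Q d e r
    fun_prop
  obtain ⟨B, hB⟩ := (isCompact_closedBall (0 : ℂ) 1).exists_bound_of_continuousOn hc.continuousOn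
  refine ⟨B, (norm_nonneg _).trans (hB 0 (by simp)), fun x hx => ?_⟩
  have h1 := (Real.le_norm_self _).trans (hB x (by simpa using hx))
  refine le_trans (le_of_eq ?_) (mul_le_mul_of_nonneg_right h1 (norm_nonneg x))
  rw [Finset.sum_mul]
  refine Finset.sum_congr rfl fun j _ => ?_
  rw [eqTerm, mul_assoc, norm_mul, mul_comm]

/-- The quotient of the power series solution by `1 / (x; Q)_∞` solves the `q`-difference
equation in the unit disc. -/
theorem functional_eq_of_seriesEq {Q d : ℂ} (hQ : ‖Q‖ < 1) {y : ℕ → ℂ} {s : Finset ℕ}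
    {F : PowerSeries ℂ} (hF : DiscSummable F) (h : SeriesEq Q d (eqPoly d y s) F) {x : ℂ}
    (hx : ‖x‖ < 1) :
    (∏ i ∈ s, (1 - d * x * y i)) * (seriesSum F x / seriesSum (eulerSeries Q 1) x) =
      seriesSum F (x * Q) / seriesSum (eulerSeries Q 1) (x * Q) +
        ∑ j ∈ Finset.Icc 1 s.card, eqTerm Q d (elemSymm y s) s.card j x *
          (seriesSum F (x * Q ^ j) / seriesSum (eulerSeries Q 1) (x * Q ^ j)) := by
  have hne : ∀ z : ℂ, ‖z‖ < 1 → seriesSum (eulerSeries Q 1) z ≠ 0 := fun z hz => by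
    rw [seriesSum_eulerSeries hQ hz]; exact inv_ne_zero (qPochInf_ne_zero hz hQ)
  have hxQ := norm_mul_lt_one hx hQ
  have h1 := functional_eq_of_binomial_sum hQ d x (elemSymm y s) (fun j => seriesSum F (x * Q ^ j))
    s.card (elemSymm_zero y s) (elemSymm_card_succ y s)
    (by simpa using h.seriesSum_eq hQ hF hx)
  have h2 := prod_one_add_mul_eq_sum_elemSymm y s (-d * x)
  simp only [Algebra.algebraMap_self, RingHom.id_apply] at h2
  have h3 : ∏ i ∈ s, (1 - d * x * y i) = ∏ i ∈ s, (1 + y i * (-d * x)) :=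
    Finset.prod_congr rfl fun i _ => by ring
  rw [← h2, ← h3] at h1
  simp only [pow_zero, mul_one, pow_one] at h1
  have h4 : ∀ j ∈ Finset.Icc 1 s.card, eqTerm Q d (elemSymm y s) s.card j x *
      (seriesSum F (x * Q ^ j) / seriesSum (eulerSeries Q 1) (x * Q ^ j)) =
      x * eqCoeff Q d (elemSymm y s) s.card j x * seriesSum F (x * Q ^ j) /
        seriesSum (eulerSeries Q 1) (x * Q) := by
    intro j hj
    obtain ⟨k, rfl⟩ : ∃ k, j = k + 1 := ⟨j - 1, by have := (Finset.mem_Icc.mp hj).1; omega⟩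
    have e1 := seriesSum_eulerSeries_mul_pow hQ hxQ k
    have e2 : ∏ h ∈ Finset.Icc 1 (k + 1 - 1), (1 - x * Q ^ h) =
        ∏ i ∈ Finset.range k, (1 - x * Q * Q ^ i) := by
      rw [Nat.add_sub_cancel, prod_Icc_eq_prod_range]
      exact Finset.prod_congr rfl fun i _ => by ring
    have e3 := hne _ (norm_mul_pow_lt_one hxQ hQ k)
    have e4 := hne _ hxQ
    rw [eqTerm, e2, show x * Q ^ (k + 1) = x * Q * Q ^ k by ring]
    rw [e1] at e3 ⊢
    have e5 := left_ne_zero_of_mul e3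
    field_simp
  rw [Finset.sum_congr rfl h4, ← Finset.sum_div, ← add_div, ← h1,
    seriesSum_eulerSeries_mul hQ hx]
  have h5 := hne x hx
  have h6 : 1 - x ≠ 0 := fun h => by
    rw [← sub_eq_zero.mp h, norm_one] at hx; exact hx.false
  field_simp

/-- The solution of the `q`-difference equation that is continuous at `0` with value `1` there
takes the value given by the infinite products at `1`. -/
theorem eq_prod_of_functional_eq {Q d : ℂ} (hQ : ‖Q‖ < 1) (hd : ‖d‖ < 1) {y : ℕ → ℂ}
    {s : Finset ℕ} (hy : ∀ i ∈ s, ‖y i‖ ≤ 1) {f : ℂ → ℂ} (hf : ContinuousAt f 0) (hf0 : f 0 = 1)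
    (hfeq : ∀ x : ℂ, ‖x‖ ≤ 1 → (∏ i ∈ s, (1 - d * x * y i)) * f x = f (x * Q) +
      ∑ j ∈ Finset.Icc 1 s.card, eqTerm Q d (elemSymm y s) s.card j x * f (x * Q ^ j)) :
    f 1 = ∏ i ∈ s, qPochInf (-y i) Q / qPochInf (d * y i) Q := by
  have hdy : ∀ i ∈ s, ‖d * y i‖ < 1 := fun i hi => by
    rw [norm_mul]; exact mul_lt_one_of_nonneg_of_lt_one_left (norm_nonneg _) hd (hy i hi)
  obtain ⟨F, hF0, hFeq, hFlim⟩ := exists_seriesEq hQ y s hdy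
  have hF := discSummable_of_tendsto hFlim
  have hE := discSummable_eulerSeries hQ
  have hne : ∀ z : ℂ, ‖z‖ < 1 → seriesSum (eulerSeries Q 1) z ≠ 0 := fun z hz => by
    rw [seriesSum_eulerSeries hQ hz]; exact inv_ne_zero (qPochInf_ne_zero hz hQ)
  set f₀ : ℂ → ℂ := fun x => seriesSum F x / seriesSum (eulerSeries Q 1) x with hf₀
  have hcont : ∀ z : ℂ, ‖z‖ < 1 → ContinuousAt f₀ z := fun z hz =>
    (hF.continuousAt hz).div₀ (hE.continuousAt hz) (hne z hz)
  obtain ⟨B, hB0, hB⟩ := exists_norm_eqTerm_le Q d (elemSymm y s) s.card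
  have hδ : 0 ≤ ‖d‖ / (1 - ‖d‖) := div_nonneg (norm_nonneg _) (by linarith)
  have huniq : ∀ x : ℂ, ‖x‖ < 1 → f x = f₀ x := by
    intro x hx
    refine sub_eq_zero.mp (eq_zero_of_dominated (g := fun x => f x - f₀ x)
      (K := s.card * (‖d‖ / (1 - ‖d‖)) + B) hQ ?_ ?_ (by positivity) hx)
    · have h := (hf.sub (hcont 0 (by simp))).tendsto
      have h0 : f 0 - f₀ 0 = 0 := by
        rw [hf0, hf₀]
        simp only [seriesSum_zero, hF0, coeff_zero_eulerSeries, div_one, sub_self]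
      rw [Pi.sub_apply, h0] at h
      exact h
    · intro z hz M hM
      have hM0 : 0 ≤ M := (norm_nonneg _).trans (hM 1 le_rfl)
      have e1 : (∏ i ∈ s, (1 - d * z * y i)) * (f z - f₀ z) = (f (z * Q) - f₀ (z * Q)) +
          ∑ j ∈ Finset.Icc 1 s.card, eqTerm Q d (elemSymm y s) s.card j z *
            (f (z * Q ^ j) - f₀ (z * Q ^ j)) := by
        simp only [mul_sub, Finset.sum_sub_distrib]
        rw [hfeq z hz.le, functional_eq_of_seriesEq hQ hF hFeq hz]
        ring
      have e2 : ‖∏ i ∈ s, (1 - d * z * y i)‖ * ‖f z - f₀ z‖ ≤ Real.exp (B * ‖z‖) * M := by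
        rw [← norm_mul, e1]
        have e3 : ‖f (z * Q) - f₀ (z * Q)‖ ≤ M := by simpa using hM 1 le_rfl
        have e4 : ‖∑ j ∈ Finset.Icc 1 s.card, eqTerm Q d (elemSymm y s) s.card j z *
            (f (z * Q ^ j) - f₀ (z * Q ^ j))‖ ≤ B * ‖z‖ * M := by
          refine (norm_sum_le _ _).trans (le_trans (Finset.sum_le_sum fun j hj => ?_)
            ((Finset.sum_mul _ _ M).symm.le.trans (mul_le_mul_of_nonneg_right (hB z hz.le) hM0)))
          rw [norm_mul]
          exact mul_le_mul_of_nonneg_left (hM j (Finset.mem_Icc.mp hj).1) (norm_nonneg _)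
        refine (norm_add_le _ _).trans ((add_le_add e3 e4).trans ?_)
        rw [← one_add_mul, add_comm (1 : ℝ)]
        exact mul_le_mul_of_nonneg_right (Real.add_one_le_exp _) hM0
      have e5 := one_le_norm_prod_mul_exp hd y s hy hz.le
      calc ‖f z - f₀ z‖ ≤ ‖∏ i ∈ s, (1 - d * z * y i)‖ *
            Real.exp (s.card * (‖d‖ / (1 - ‖d‖)) * ‖z‖) * ‖f z - f₀ z‖ :=
            le_mul_of_one_le_left (norm_nonneg _) e5
        _ = Real.exp (s.card * (‖d‖ / (1 - ‖d‖)) * ‖z‖) *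
            (‖∏ i ∈ s, (1 - d * z * y i)‖ * ‖f z - f₀ z‖) := by ring
        _ ≤ Real.exp (s.card * (‖d‖ / (1 - ‖d‖)) * ‖z‖) * (Real.exp (B * ‖z‖) * M) :=
            mul_le_mul_of_nonneg_left e2 (Real.exp_pos _).le
        _ = _ := by rw [← mul_assoc, ← Real.exp_add, add_mul]
  have hfc : ∀ z : ℂ, ‖z‖ < 1 → ContinuousAt f z := by
    intro z hz
    refine (hcont z hz).congr ?_
    filter_upwards [Metric.isOpen_ball.mem_nhds (show z ∈ Metric.ball (0 : ℂ) 1 by simpa using hz)]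
      with w hw
    exact (huniq w (by simpa using hw)).symm
  -- the equation at `1` only involves values of `f` inside the disc, so that `f` is the limit of
  -- its values at `t < 1`
  have hlt : Filter.Tendsto (fun t : ℝ => (t : ℂ)) (nhdsWithin 1 (Set.Iio 1)) (nhds 1) :=
    (Complex.continuous_ofReal.tendsto' 1 1 Complex.ofReal_one).mono_left nhdsWithin_le_nhds
  have hmem : ∀ᶠ t : ℝ in nhdsWithin 1 (Set.Iio 1), ‖(t : ℂ)‖ < 1 := by
    filter_upwards [Ioo_mem_nhdsLT (show (0 : ℝ) < 1 by norm_num)] with t ht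
    rw [Complex.norm_real, Real.norm_of_nonneg ht.1.le]; exact ht.2
  have hp : ∀ x : ℂ, ‖x‖ ≤ 1 → ∏ i ∈ s, (1 - d * x * y i) ≠ 0 := by
    intro x hx h0
    have := one_le_norm_prod_mul_exp hd y s hy hx
    rw [h0, norm_zero, zero_mul] at this
    linarith
  have hlim1 : Filter.Tendsto (fun t : ℝ => f t) (nhdsWithin 1 (Set.Iio 1)) (nhds (f 1)) := by
    have hcR : ContinuousAt (fun x : ℂ => (f (x * Q) +
        ∑ j ∈ Finset.Icc 1 s.card, eqTerm Q d (elemSymm y s) s.card j x * f (x * Q ^ j)) /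
          ∏ i ∈ s, (1 - d * x * y i)) 1 := by
      have hj : ∀ j : ℕ, 1 ≤ j → ContinuousAt (fun x : ℂ => f (x * Q ^ j)) 1 := by
        intro j hj
        have : ‖(1 : ℂ) * Q ^ j‖ < 1 := by
          rw [one_mul, norm_pow]; exact pow_lt_one₀ (norm_nonneg _) hQ (by omega)
        exact ContinuousAt.comp (f := fun x : ℂ => x * Q ^ j) (hfc _ this) (by fun_prop)
      refine ContinuousAt.div₀ (ContinuousAt.add (by simpa using hj 1 le_rfl) ?_)
        (by fun_prop) (hp 1 (by simp))
      exact tendsto_finsetSum _ fun j hj' =>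
        ((continuous_eqTerm _ _ _ _ _).continuousAt).mul (hj j (Finset.mem_Icc.mp hj').1)
    have h := hcR.tendsto.comp hlt
    rw [← hfeq 1 (by simp), mul_div_cancel_left₀ _ (hp 1 (by simp))] at h
    refine h.congr' ?_
    filter_upwards [hmem] with t ht
    rw [Function.comp_apply, ← hfeq t ht.le, mul_div_cancel_left₀ _ (hp t ht.le)]
  have hlim2 : Filter.Tendsto (fun t : ℝ => f t) (nhdsWithin 1 (Set.Iio 1))
      (nhds (∏ i ∈ s, qPochInf (-y i) Q / qPochInf (d * y i) Q)) := by
    have hEc : Filter.Tendsto (fun t : ℝ => seriesSum (eulerSeries Q 1) (t * Q))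
        (nhdsWithin 1 (Set.Iio 1)) (nhds (seriesSum (eulerSeries Q 1) Q)) :=
      (hE.continuousAt hQ).tendsto.comp (by simpa using hlt.mul_const Q)
    have h := (tendsto_one_sub_mul_seriesSum hFlim).div hEc (hne Q hQ)
    rw [seriesSum_eulerSeries hQ hQ,
      mul_div_cancel_right₀ _ (inv_ne_zero (qPochInf_ne_zero hQ hQ))] at h
    refine h.congr' ?_
    filter_upwards [hmem] with t ht
    have h1 : 1 - (t : ℂ) ≠ 0 := fun h => by
      rw [← sub_eq_zero.mp h, norm_one] at ht; exact ht.false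
    rw [Pi.div_apply, huniq t ht, seriesSum_eulerSeries_mul hQ ht, mul_div_mul_left _ _ h1]
  exact tendsto_nhds_unique hlim1 hlim2

/-! ### Sums of distinct elements of a superincreasing sequence -/

/-- The largest index decides: if only one of two sets contains it, that set has the larger sum. -/
theorem sum_injOn_powerset {a : ℕ → ℕ} {r : ℕ}
    (ha : ∀ k ∈ Finset.Icc 1 r, ∑ i ∈ Finset.Ico 1 k, a i < a k) :
    Set.InjOn (fun T : Finset ℕ => ∑ i ∈ T, a i) ((Finset.Icc 1 r).powerset : Set (Finset ℕ)) := by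
  induction r with
  | zero =>
    intro T hT T' hT' _
    simp at hT hT'
    rw [hT, hT']
  | succ r ih =>
    have ih' := ih fun k hk => ha k (Finset.Icc_subset_Icc_right r.le_succ hk)
    have hlast := ha (r + 1) (by simp)
    have hIcc : (Finset.Icc 1 (r + 1)).erase (r + 1) = Finset.Icc 1 r := by
      ext i; simp only [Finset.mem_erase, Finset.mem_Icc]; omega
    have hIco : Finset.Ico 1 (r + 1) = Finset.Icc 1 r := by
      ext i; simp only [Finset.mem_Ico, Finset.mem_Icc]; omega
    rw [hIco] at hlast
    have herase : ∀ T ⊆ Finset.Icc 1 (r + 1), T.erase (r + 1) ⊆ Finset.Icc 1 r := fun T hT => by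
      rw [← hIcc]; exact Finset.erase_subset_erase _ hT
    have hlt : ∀ T ⊆ Finset.Icc 1 (r + 1), r + 1 ∉ T → ∑ i ∈ T, a i < a (r + 1) :=
      fun T hT h => lt_of_le_of_lt
        (Finset.sum_le_sum_of_subset (by simpa [Finset.erase_eq_of_notMem h] using herase T hT)) hlast
    intro T hT T' hT' h
    rw [Finset.mem_coe, Finset.mem_powerset] at hT hT'
    simp only at h
    have hiff : r + 1 ∈ T ↔ r + 1 ∈ T' := by
      constructor <;> intro h1 <;> by_contra h2
      · have := hlt T' hT' h2
        have := Finset.single_le_sum (fun i _ => Nat.zero_le (a i)) h1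
        omega
      · have := hlt T hT h2
        have := Finset.single_le_sum (fun i _ => Nat.zero_le (a i)) h1
        omega
    have key : T.erase (r + 1) = T'.erase (r + 1) := by
      refine ih' (Finset.mem_coe.mpr (Finset.mem_powerset.mpr (herase T hT)))
        (Finset.mem_coe.mpr (Finset.mem_powerset.mpr (herase T' hT'))) ?_
      simp only
      by_cases h1 : r + 1 ∈ T
      · have e1 := Finset.add_sum_erase T a h1
        have e2 := Finset.add_sum_erase T' a (hiff.mp h1)
        omega
      · rwa [Finset.erase_eq_of_notMem h1, Finset.erase_eq_of_notMem (fun h2 => h1 (hiff.mpr h2))]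
    by_cases h1 : r + 1 ∈ T
    · rw [← Finset.insert_erase h1, ← Finset.insert_erase (hiff.mp h1), key]
    · rwa [Finset.erase_eq_of_notMem h1, Finset.erase_eq_of_notMem (fun h2 => h1 (hiff.mpr h2))]
        at key

theorem weight_sum {a : ℕ → ℕ} {r : ℕ}
    (ha : ∀ k ∈ Finset.Icc 1 r, ∑ i ∈ Finset.Ico 1 k, a i < a k) {T : Finset ℕ}
    (hT : T ⊆ Finset.Icc 1 r) : weight a r (∑ i ∈ T, a i) = T.card := by
  have : {n | ∃ T' ⊆ Finset.Icc 1 r, ∑ i ∈ T', a i = ∑ i ∈ T, a i ∧ T'.card = n} = {T.card} := by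
    ext n
    constructor
    · rintro ⟨T', hT', h, rfl⟩
      rw [sum_injOn_powerset ha (Finset.mem_coe.mpr (Finset.mem_powerset.mpr hT'))
        (Finset.mem_coe.mpr (Finset.mem_powerset.mpr hT)) h]
      rfl
    · rintro rfl
      exact ⟨T, hT, rfl, rfl⟩
  rw [weight, this, csInf_singleton]

/-- The sum of `q ^ α` over the `α` of weight `k ≥ 1` is an elementary symmetric function; the
condition `α < a (r + 1)` holds for all of them. -/
theorem sum_filter_weight {a : ℕ → ℕ} {r N : ℕ} (hr : 1 ≤ r)
    (ha : ∀ k ∈ Finset.Icc 1 r, ∑ i ∈ Finset.Ico 1 k, a i < a k)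
    (hN : ∑ i ∈ Finset.Icc 1 r, a i ≤ N) (q : ℂ) {k : ℕ} (hk : 1 ≤ k) :
    ∑ α ∈ (sumSet a r).filter (fun α => α < N + a 1 ∧ weight a r α = k), q ^ α =
      elemSymm (fun i => q ^ a i) (Finset.Icc 1 r) k := by
  have h1 : (sumSet a r).filter (fun α => α < N + a 1 ∧ weight a r α = k) =
      ((Finset.Icc 1 r).powersetCard k).image fun T => ∑ i ∈ T, a i := by
    ext α
    simp only [sumSet, Finset.mem_filter, Finset.mem_image, Finset.mem_erase, Finset.mem_powerset,
      Finset.mem_powersetCard]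
    constructor
    · rintro ⟨⟨T, ⟨_, hT⟩, rfl⟩, _, hw⟩
      exact ⟨T, ⟨hT, by rw [← hw, weight_sum ha hT]⟩, rfl⟩
    · rintro ⟨T, ⟨hT, rfl⟩, rfl⟩
      refine ⟨⟨T, ⟨?_, hT⟩, rfl⟩, ?_, weight_sum ha hT⟩
      · exact Finset.nonempty_iff_ne_empty.mp (Finset.card_pos.mp hk)
      · have ha1 := ha 1 (by simp [hr])
        have := Finset.sum_le_sum_of_subset (f := a) hT
        omega
  rw [h1, Finset.sum_image, elemSymm]
  · exact Finset.sum_congr rfl fun T _ => (Finset.prod_pow_eq_pow_sum T a q).symm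
  · exact (sum_injOn_powerset ha).mono fun T hT => by
      rw [Finset.mem_coe, Finset.mem_powersetCard] at hT
      exact Finset.mem_coe.mpr (Finset.mem_powerset.mpr hT.1)

/-- `QDiffEq`, with the inner sums replaced by elementary symmetric functions
and the integer exponent `m - 1` by a natural one. -/
theorem functional_eq_of_qDiffEq {a : ℕ → ℕ} {r N : ℕ} (hr : 1 ≤ r)
    (ha : ∀ k ∈ Finset.Icc 1 r, ∑ i ∈ Finset.Ico 1 k, a i < a k)
    (hN : ∑ i ∈ Finset.Icc 1 r, a i ≤ N) {d q : ℂ} {f : ℂ → ℂ} {x : ℂ}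
    (h : QDiffEq a r N d q f x) :
    (∏ i ∈ Finset.Icc 1 r, (1 - d * x * q ^ a i)) * f x = f (x * q ^ N) +
      ∑ j ∈ Finset.Icc 1 r,
        eqTerm (q ^ N) d (elemSymm (fun i => q ^ a i) (Finset.Icc 1 r)) r j x *
          f (x * (q ^ N) ^ j) := by
  rw [QDiffEq] at h
  rw [h]
  congr 1
  refine Finset.sum_congr rfl fun j hj => ?_
  have hj1 := (Finset.mem_Icc.mp hj).1
  rw [eqTerm, eqCoeff, Finset.mul_sum]
  simp only [← pow_mul, mul_comm N]
  congr 2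
  refine Finset.sum_congr rfl fun m _ => ?_
  rw [← sum_filter_weight hr ha hN q (k := j + m) (by omega), ← Finset.sum_mul, ← Finset.mul_sum]
  rcases m with _ | m
  · rw [qBinom_of_neg (by simp : ((0 : ℕ) : ℤ) - 1 < 0)]
    simp
    ring
  · have : (-x) ^ (((m + 1 : ℕ) : ℤ) - 1) = (-x) ^ (m + 1 - 1) := by
      rw [Nat.add_sub_cancel, Nat.cast_succ, add_sub_cancel_right, zpow_natCast]
    rw [this]
    ring

/-! ### The theorem for `QDiffEq` -/

theorem theorem6 (r : ℕ) (hr : 1 ≤ r) (a : ℕ → ℕ)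
    (ha : ∀ k ∈ Finset.Icc 1 r, ∑ i ∈ Finset.Ico 1 k, a i < a k)
    (N : ℕ) (hN : ∑ i ∈ Finset.Icc 1 r, a i ≤ N)
    (d q : ℂ) (hd : ‖d‖ < 1) (hq : ‖q‖ < 1)
    (f : ℂ → ℂ) (hf : ContinuousAt f 0) (hf0 : f 0 = 1)
    (hfeq : ∀ x : ℂ, ‖x‖ ≤ 1 → QDiffEq a r N d q f x) :
    f 1 = ∏ k ∈ Finset.Icc 1 r,
      qPochInf (-q ^ a k) (q ^ N) / qPochInf (d * q ^ a k) (q ^ N) := by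
  have hN0 : N ≠ 0 := by
    have h1 := ha 1 (by simp [hr])
    have h2 := Finset.single_le_sum (f := a) (fun i _ => Nat.zero_le _)
      (Finset.mem_Icc.mpr ⟨le_rfl, hr⟩)
    omega
  have hQ : ‖q ^ N‖ < 1 := by rw [norm_pow]; exact pow_lt_one₀ (norm_nonneg _) hq hN0
  have hcard : (Finset.Icc 1 r).card = r := by simp
  refine eq_prod_of_functional_eq hQ hd (y := fun i => q ^ a i) (fun i _ => ?_) hf hf0 fun x hx => ?_
  · rw [norm_pow]; exact pow_le_one₀ (norm_nonneg _) hq.le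
  · rw [hcard]
    exact functional_eq_of_qDiffEq hr ha hN (hfeq x hx)
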